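/- Let $n \ge 3$, let $C_{2^n}$ be a cyclic group of order $2^n$, and let $G = \mathrm{Hol}(C_{2^n}) = C_{2^n} \rtimes \mathrm{Aut}(C_{2^n})$ be its holomorph, the semidirect product with respect to the natural action. For $m \ge 1$ let $\zeta_m$ denote a primitive $m$-th root of unity, and for a ring $R$ write $R^{(2)} = R \oplus R$. Then the Wedderburn decomposition of the rational group algebra of $G$ is given by the isomorphism of $\mathbb{Q}$-algebras $$\mathbb{Q}[G] \;\cong\; \bigoplus_{d \mid 2^{n-2}} \mathbb{Q}(\zeta_d)^{(2)} \;\oplus\; \bigoplus_{d \mid 2^{n-2}} \mathbb{Q}(\zeta_d)^{(2)} \;\oplus\; \bigoplus_{k=2}^{n} \bigoplus_{l=0}^{n-k} M_{2^{k-1}}\bigl(\mathbb{Q}(\zeta_{2^l})\bigr).$$ -/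

import Mathlib

/-- The holomorph `Hol(G) = G ⋊ Aut(G)` of a group `G`, the semidirect product with respect to the
natural action of `Aut(G)` on `G`. -/
abbrev Holomorph (G : Type*) [Group G] : Type _ :=
  G ⋊[MonoidHom.id (MulAut G)] MulAut G

/-! An injective homomorphism from `ℚ[G]` to the right-hand side is built; both have dimension `2^n
* 2^(n-1)`, so it is an isomorphism.

Let `L = ℚ(ζ_{2^n})`. Both `Aut(C)` and `Gal(L/ℚ)` are the units mod `2^n`, so for a character `χ`
of order `2^k`, `G` acts on `L`: `C` by multiplication through `χ`, `Aut(C)` by Galois automorphisms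
(`holomorphRep`). For `k ≥ 2` this commutes with a generator `σ`, of order `2^(n-k)`, of the Galois
group over `ℚ(ζ_{2^k})`. The kernels of `Φ_{2^l}(σ)`, `l ≤ n - k`, span `L`, and each is a
`2^(k-1)`-dimensional space over `ℚ(ζ_{2^l})`: these are the matrix blocks. The characters of `C` of
order 1 and 2 are `Aut(C)`-invariant; multiplied by characters of `Aut(C) ≅ {±1} × ⟨5⟩` they give
the two families of fields.

If `x` dies in every block, independence of automorphisms (for `k ≥ 2`) or separation by characters
of `Aut(C)` makes each slice `c ↦ x(c, u)` orthogonal to a character of every order dividing `2^n`.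
Such a slice, read as a polynomial of degree less than `2^n`, is divisible by every `Φ_d` with `d ∣
2^n`, hence zero. -/

open Polynomial

/-! ### Characters of finite cyclic groups -/

/-- A rational polynomial of degree less than `N` which is divisible by all cyclotomic polynomials
of order dividing `N` vanishes. -/
lemma Polynomial.eq_zero_of_forall_cyclotomic_dvd {N : ℕ} (hN : 0 < N) {p : ℚ[X]}
    (hdeg : p.degree < N) (h : ∀ d, d ∣ N → cyclotomic d ℚ ∣ p) : p = 0 := by
  have hdvd : (X ^ N - 1 : ℚ[X]) ∣ p := by
    rw [← prod_cyclotomic_eq_X_pow_sub_one hN ℚ]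
    exact Finset.prod_dvd_of_coprime (fun a _ b _ hab ↦ cyclotomic.isCoprime_rat hab)
      fun d hd ↦ h d (Nat.dvd_of_mem_divisors hd)
  refine eq_zero_of_dvd_of_degree_lt hdvd ?_
  rwa [← C_1, degree_X_pow_sub_C hN]

/-- A rational function on a finite cyclic group is zero if, for every divisor `d` of the order of
the group, it is orthogonal to a character of order `d`. -/
lemma eq_zero_of_forall_sum_character {C : Type*} [Group C] [Fintype C] {g : C}
    (hg : ∀ x, x ∈ Subgroup.zpowers g) (f : C → ℚ)
    (h : ∀ d, d ∣ Fintype.card C → ∃ (K : Type) (_ : Field K) (_ : CharZero K) (χ : C →* K),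
      IsPrimitiveRoot (χ g) d ∧ ∑ c, (f c : K) * χ c = 0) : f = 0 := by
  classical
  set N := Fintype.card C
  have hN : 0 < N := Fintype.card_pos
  have hord : orderOf g = N := by
    rw [orderOf_eq_card_of_forall_mem_zpowers hg, Nat.card_eq_fintype_card]
  have himg : (Finset.range N).image (g ^ ·) = Finset.univ := by
    have := IsCyclic.image_range_card hg
    rwa [Nat.card_eq_fintype_card] at this
  let p : ℚ[X] := ∑ j ∈ Finset.range N, Polynomial.C (f (g ^ j)) * X ^ j
  have hp : p = 0 := by
    refine eq_zero_of_forall_cyclotomic_dvd hN ?_ fun d hd ↦ ?_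
    · refine (degree_sum_le _ _).trans_lt ?_
      rw [Finset.sup_lt_iff (by exact WithBot.bot_lt_coe N)]
      intro j hj
      exact (degree_C_mul_X_pow_le _ _).trans_lt (by exact_mod_cast Finset.mem_range.1 hj)
    · obtain ⟨K, _, _, χ, hχ, hsum⟩ := h d hd
      rw [cyclotomic_eq_minpoly_rat hχ (Nat.pos_of_dvd_of_pos hd hN)]
      refine minpoly.dvd _ _ ?_
      rw [← hsum, ← himg, Finset.sum_image]
      · simp [p]
      · intro a ha b hb hab
        exact pow_injOn_Iio_orderOf (by simpa [hord] using ha) (by simpa [hord] using hb) hab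
  funext c
  obtain ⟨j, hj, rfl⟩ : ∃ j ∈ Finset.range N, g ^ j = c := by
    rw [← Finset.mem_image, himg]
    exact Finset.mem_univ c
  have := congrArg (coeff · j) hp
  simpa [p, coeff_X_pow, Finset.mem_range.1 hj] using this

/-- A finite cyclic group with generator `g` has a character with any prescribed root of unity of
suitable order as its value at `g`. -/
lemma IsPrimitiveRoot.exists_monoidHom_apply_eq {C K : Type*} [Group C] [Finite C] [Field K] {g : C}
    (hg : ∀ x, x ∈ Subgroup.zpowers g) {z : K} {d : ℕ} (hz : IsPrimitiveRoot z d)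
    (hd : d ∣ Nat.card C) : ∃ χ : C →* K, χ g = z := by
  have hd0 : d ≠ 0 := fun h ↦ Nat.card_pos.ne' (Nat.zero_dvd.1 (h ▸ hd))
  obtain ⟨z, rfl⟩ := hz.isUnit hd0
  have hdvd : orderOf z ∣ orderOf g := by
    rwa [← orderOf_units, ← hz.eq_orderOf, orderOf_eq_card_of_forall_mem_zpowers hg]
  refine ⟨(Units.coeHom _).comp (monoidHomOfForallMemZpowers hg hdvd), ?_⟩
  rw [MonoidHom.comp_apply, monoidHomOfForallMemZpowers_apply_gen, Units.coeHom_apply]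

/-! ### Splitting a representation along a commuting endomorphism -/

/-- Let `φ` be a representation of an algebra `A` on `L` and let `w` be an endomorphism of `L`
commuting with it. The kernel of `P(w)` for an irreducible polynomial `P` is a representation of `A`
over the field `K = F[X]/(P)`. -/
lemma exists_algHom_matrix_of_commute {F A K L : Type*} [Field F] [Ring A] [Algebra F A]
    [Field K] [Algebra F K] [AddCommGroup L] [Module F L] [FiniteDimensional F L]
    (φ : A →ₐ[F] Module.End F L) (w : Module.End F L) (hw : ∀ a, Commute (φ a) w)
    (pb : PowerBasis F K) {N : ℕ}
    (hN : Module.finrank F (LinearMap.ker (aeval w (minpoly F pb.gen))) = Module.finrank F K * N) :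
    ∃ Ψ : A →ₐ[F] Matrix (Fin N) (Fin N) K,
      ∀ a, Ψ a = 0 → LinearMap.ker (aeval w (minpoly F pb.gen)) ≤ LinearMap.ker (φ a) := by
  set P := minpoly F pb.gen with hP
  set V := LinearMap.ker (aeval w P) with hV
  have hcomm (a : A) (q : F[X]) : Commute (φ a) (aeval w q) := by
    induction q using Polynomial.induction_on' with
    | add p q hp hq => simpa using hp.add_right hq
    | monomial n r =>
      rw [aeval_monomial]
      exact Commute.mul_right (Algebra.commutes r (φ a)).symm ((hw a).pow_right n)
  have hstab (a : A) : ∀ v ∈ V, φ a v ∈ V := fun v hv ↦ by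
    rw [hV, LinearMap.mem_ker] at hv ⊢
    have := LinearMap.congr_fun (hcomm a P).eq v
    simp only [Module.End.mul_apply] at this
    rw [← this, hv, map_zero]
  have hwstab : ∀ v ∈ V, w v ∈ V := fun v hv ↦ by
    rw [hV, LinearMap.mem_ker] at hv ⊢
    have := LinearMap.congr_fun (Commute.eq (aeval_X (R := F) w ▸ Commute.map (Commute.all X P) (aeval w))) v
    simp only [Module.End.mul_apply] at this
    rw [← this, hv, map_zero]
  let wV : Module.End F V := w.restrict hwstab
  have haeval (q : F[X]) (v : V) : (aeval wV q v : L) = aeval w q v := by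
    induction q using Polynomial.induction_on' generalizing v with
    | add p q hp hq => simp [hp, hq]
    | monomial n r =>
      have : ∀ v : V, ((wV ^ n) v : L) = (w ^ n) v := by
        induction n with
        | zero => simp
        | succ n ih => intro v; rw [pow_succ, pow_succ, Module.End.mul_apply, ih]; rfl
      simp [aeval_monomial, this, Module.algebraMap_end_apply]
  have hroot : aeval wV P = 0 := by
    ext v
    rw [haeval]
    exact v.2
  let ι : K →ₐ[F] Module.End F V := pb.lift wV hroot
  let _ : Module K V := Module.compHom V ι.toRingHom
  have hsmul (x : K) (v : V) : x • v = ι x v := rfl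
  have : IsScalarTower F K V := ⟨fun r x v ↦ by simp [hsmul]⟩
  have : Module.Finite K V := Module.Finite.of_restrictScalars_finite F K V
  have : FiniteDimensional F K := pb.finite
  have hfin : Module.finrank K V = N := by
    have h := Module.finrank_mul_finrank F K V
    rw [hN] at h
    exact Nat.eq_of_mul_eq_mul_left Module.finrank_pos h
  let Φ : A →ₐ[F] Module.End K V := AlgHom.ofLinearMap
    { toFun := fun a ↦
        { toFun := (φ a).restrict (hstab a)
          map_add' := map_add _
          map_smul' := fun x v ↦ by
            -- Every scalar of `K` acts as some `q(w)`, which commutes with `φ a`.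
            obtain ⟨q, rfl⟩ := pb.exists_eq_aeval' x
            ext
            have := LinearMap.congr_fun (hcomm a q).eq (v : L)
            simp only [Module.End.mul_apply] at this
            simp [hsmul, ι, haeval, this] }
      map_add' := fun a b ↦ by ext v; simp
      map_smul' := fun r a ↦ by ext v; simp }
    (by ext v; simp) (fun a b ↦ by ext v; simp)
  let b := Module.finBasisOfFinrankEq K V hfin
  refine ⟨((algEquivMatrix b).toAlgHom.restrictScalars F).comp Φ, fun a ha v hv ↦ ?_⟩
  have h0 : Φ a = 0 := (algEquivMatrix b).injective (by simpa using ha)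
  have := congrArg Subtype.val (LinearMap.congr_fun h0 ⟨v, hv⟩)
  exact this

/-! ### Cyclotomic kernels of a field automorphism -/

lemma AlgEquiv.toLinearMap_pow_eq {F L : Type*} [Field F] [Field L] [Algebra F L]
    (σ : Gal(L/F)) (j : ℕ) :
    (σ.toLinearMap : Module.End F L) ^ j = (σ ^ j).toLinearMap := by
  induction j with
  | zero => rfl
  | succ j ih => rw [pow_succ, ih, pow_succ]; rfl

lemma AlgEquiv.finrank_ker_sub_one {F L : Type*} [Field F] [Field L] [Algebra F L]
    [FiniteDimensional F L] (σ : Gal(L/F)) :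
    Module.finrank F (LinearMap.ker ((σ.toLinearMap : Module.End F L) - 1)) * orderOf σ =
      Module.finrank F L := by
  have h1 := IntermediateField.finrank_fixedField_eq_card (Subgroup.zpowers σ)
  have h2 := Module.finrank_mul_finrank F
    (IntermediateField.fixedField (Subgroup.zpowers σ)) L
  rw [h1, Nat.card_zpowers] at h2
  have h3 : LinearMap.ker ((σ.toLinearMap : Module.End F L) - 1) =
      Subalgebra.toSubmodule (IntermediateField.fixedField (Subgroup.zpowers σ)).toSubalgebra := by
    ext x
    simp only [LinearMap.mem_ker, LinearMap.sub_apply, Module.End.one_apply, sub_eq_zero,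
      AlgEquiv.toLinearMap_apply, Subalgebra.mem_toSubmodule,
      IntermediateField.mem_toSubalgebra, IntermediateField.mem_fixedField_iff]
    refine ⟨fun h f hf ↦ ?_, fun h ↦ h σ (Subgroup.mem_zpowers σ)⟩
    have : Subgroup.zpowers σ ≤ MulAction.stabilizer Gal(L/F) x := by
      rw [Subgroup.zpowers_le]; exact h
    exact this hf
  rw [h3]
  exact h2

lemma Polynomial.cyclotomic_two_pow_succ_mul (l : ℕ) :
    (X ^ 2 ^ l - 1) * cyclotomic (2 ^ (l + 1)) ℚ = X ^ 2 ^ (l + 1) - 1 := by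
  rw [mul_comm]
  exact cyclotomic_prime_pow_mul_X_pow_sub_one ℚ 2 l

lemma Polynomial.isCoprime_X_pow_sub_one_cyclotomic (l : ℕ) :
    IsCoprime (X ^ 2 ^ l - 1) (cyclotomic (2 ^ (l + 1)) ℚ) := by
  have : (X ^ 2 ^ (l + 1) - 1 : ℚ[X]).Separable :=
    X_pow_sub_one_separable_iff.2 (by simp)
  rw [← cyclotomic_two_pow_succ_mul] at this
  exact this.isCoprime

section

variable {L : Type*} [Field L] [Algebra ℚ L] (σ : Gal(L/ℚ))

/-- By Artin's theorem the fixed field of `σ ^ 2^m` has dimension `2^m * M`. For `l ≥ 1`, `Φ_{2^l}`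
is a quotient of two consecutive `X^(2^m) - 1` with coprime factors, so the dimensions subtract. -/
lemma AlgEquiv.finrank_ker_aeval_cyclotomic [FiniteDimensional ℚ L] {r M : ℕ}
    (hσ : orderOf σ = 2 ^ r) (hL : Module.finrank ℚ L = 2 ^ r * M) {l : ℕ} (hl : l ≤ r) :
    Module.finrank ℚ (LinearMap.ker
      (aeval (σ.toLinearMap : Module.End ℚ L) (cyclotomic (2 ^ l) ℚ))) =
      (2 ^ l).totient * M := by
  set w : Module.End ℚ L := σ.toLinearMap with hw
  have key (m : ℕ) (hm : m ≤ r) :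
      Module.finrank ℚ (LinearMap.ker (aeval w (X ^ 2 ^ m - 1 : ℚ[X]))) = 2 ^ m * M := by
    have h := (σ ^ 2 ^ m).finrank_ker_sub_one
    obtain ⟨s, rfl⟩ := Nat.exists_eq_add_of_le hm
    rw [orderOf_pow, hσ, hL, pow_add, Nat.gcd_mul_right_left, Nat.mul_div_cancel_left _ (by simp),
      ← AlgEquiv.toLinearMap_pow_eq, mul_right_comm] at h
    have := Nat.eq_of_mul_eq_mul_right (by simp) h
    rw [show aeval w (X ^ 2 ^ m - 1 : ℚ[X]) = w ^ 2 ^ m - 1 by simp]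
    exact this
  rcases l with _ | l
  · have := key 0 (Nat.zero_le _)
    rw [pow_zero, pow_one, one_mul] at this
    rw [pow_zero, cyclotomic_one, Nat.totient_one, one_mul, this]
  · have h1 := key l (by lia)
    have h2 := key (l + 1) hl
    have hc := isCoprime_X_pow_sub_one_cyclotomic l
    rw [← cyclotomic_two_pow_succ_mul, ← sup_ker_aeval_eq_ker_aeval_mul_of_coprime _ hc] at h2
    have h3 := Submodule.finrank_sup_add_finrank_inf_eq
      (LinearMap.ker (aeval w (X ^ 2 ^ l - 1 : ℚ[X])))
      (LinearMap.ker (aeval w (cyclotomic (2 ^ (l + 1)) ℚ)))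
    rw [(disjoint_ker_aeval_of_isCoprime w hc).eq_bot, finrank_bot, h1, h2] at h3
    rw [Nat.totient_prime_pow_succ Nat.prime_two]
    simp only [add_zero, Nat.add_one_sub_one, mul_one] at h3 ⊢
    rw [show 2 ^ (l + 1) * M = 2 ^ l * M + 2 ^ l * M by ring] at h3
    exact (Nat.add_left_cancel h3).symm

lemma AlgEquiv.eq_top_of_ker_aeval_cyclotomic_le {r : ℕ} (hσ : σ ^ 2 ^ r = 1)
    (S : Submodule ℚ L)
    (h : ∀ l ≤ r, LinearMap.ker
      (aeval (σ.toLinearMap : Module.End ℚ L) (cyclotomic (2 ^ l) ℚ)) ≤ S) : S = ⊤ := by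
  set w : Module.End ℚ L := σ.toLinearMap with hw
  have key (m : ℕ) (hm : m ≤ r) : LinearMap.ker (aeval w (X ^ 2 ^ m - 1 : ℚ[X])) ≤ S := by
    induction m with
    | zero => simpa using h 0 hm
    | succ m ih =>
      rw [← cyclotomic_two_pow_succ_mul,
        ← sup_ker_aeval_eq_ker_aeval_mul_of_coprime _ (isCoprime_X_pow_sub_one_cyclotomic m)]
      exact sup_le (ih (by lia)) (h _ hm)
  rw [eq_top_iff]
  refine le_trans (fun x _ ↦ ?_) (key r le_rfl)
  simp [hw, AlgEquiv.toLinearMap_pow_eq, hσ]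

end

/-! ### The action of the holomorph on a cyclotomic field -/

/-- The automorphisms of a finite cyclic group of order `N` are the power maps. -/
lemma IsCyclic.exists_mulAut_equiv_units (C : Type*) [Group C] [IsCyclic C] {N : ℕ} [NeZero N]
    (hC : Nat.card C = N) :
    ∃ e : MulAut C ≃* (ZMod N)ˣ, ∀ u c, u c = c ^ (e u : ZMod N).val := by
  subst hC
  refine ⟨IsCyclic.mulAutMulEquiv C, fun u c ↦ ?_⟩
  obtain ⟨z, rfl⟩ := (zmodCyclicMulEquiv ‹_›).surjective c
  obtain ⟨z, rfl⟩ := Multiplicative.ofAdd.surjective z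
  rw [← map_pow, ← ofAdd_nsmul, nsmul_eq_mul, ZMod.natCast_val, ZMod.cast_id]
  set ε := zmodCyclicMulEquiv (G := C) ‹_›
  let f : AddAut (ZMod (Nat.card C)) :=
    (MulAutMultiplicative (ZMod (Nat.card C)) ((ε.trans u).trans ε.symm)).toAdd
  have hf : f 1 * z = f z := by
    rw [mul_comm, ← z.intCast_zmod_cast, ← zsmul_eq_mul, ← map_zsmul, zsmul_one]
  have hfz : Multiplicative.ofAdd (f z) = ε.symm (u (ε (Multiplicative.ofAdd z))) := rfl
  calc u (ε (Multiplicative.ofAdd z)) = ε (Multiplicative.ofAdd (f z)) := by simp [hfz]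
    _ = ε (Multiplicative.ofAdd (f 1 * z)) := by rw [hf]
    _ = _ := rfl

/-- The exponent has the same form as in `IsCyclic.exists_mulAut_equiv_units`, so that characters
intertwine the two actions. -/
lemma IsCyclotomicExtension.exists_gal_equiv_units {N : ℕ} [NeZero N] (L : Type*) [Field L]
    [Algebra ℚ L] [IsCyclotomicExtension {N} ℚ L] :
    ∃ e : Gal(L/ℚ) ≃* (ZMod N)ˣ, ∀ σ (x : L), x ^ N = 1 → σ x = x ^ (e σ : ZMod N).val := by
  refine ⟨autEquivPow L (cyclotomic.irreducible_rat (NeZero.pos N)), fun σ x hx ↦ ?_⟩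
  obtain ⟨i, -, rfl⟩ := (zeta_spec N ℚ L).eq_pow_of_pow_eq_one hx
  have := (zeta_spec N ℚ L).autToPow_spec ℚ σ
  rw [map_pow, ← this, pow_right_comm]
  rfl

/-- The defining property of `CyclotomicField d ℚ`, for its structure of `ℚ`-algebra as a division
ring of characteristic zero. -/
instance CyclotomicField.isCyclotomicExtension_rat (d : ℕ) [NeZero d] :
    IsCyclotomicExtension {d} ℚ (CyclotomicField d ℚ) := by
  convert! CyclotomicField.isCyclotomicExtension d ℚ

/-- The action of the holomorph of `C` on a field `L` in which `C` acts by multiplication through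
a character and `Aut(C)` acts by field automorphisms. -/
noncomputable def holomorphRep {C F L : Type*} [Group C] [Field F] [Field L] [Algebra F L]
    (χ : C →* L) (S : MulAut C →* Gal(L/F)) (h : ∀ u c, S u (χ c) = χ (u c)) :
    Holomorph C →* Module.End F L where
  toFun g := LinearMap.mulLeft F (χ g.left) * (S g.right).toLinearMap
  map_one' := by ext; simp
  map_mul' g g' := by ext; simp [h, mul_assoc]

lemma MonoidAlgebra.lift_holomorph_apply {C F A : Type*} [Group C] [Fintype C] [Fintype (MulAut C)]
    [Field F] [Ring A] [Algebra F A] (ρ : Holomorph C →* A) (x : MonoidAlgebra F (Holomorph C)) :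
    MonoidAlgebra.lift F A (Holomorph C) ρ x = ∑ u, ∑ c, x.coeff ⟨c, u⟩ • ρ ⟨c, u⟩ := by
  let _ : Fintype (Holomorph C) := Fintype.ofEquiv _ SemidirectProduct.equivProd.symm
  rw [MonoidAlgebra.lift_apply, Finsupp.sum_fintype _ _ (by simp),
    ← Equiv.sum_comp SemidirectProduct.equivProd.symm, Fintype.sum_prod_type_right]
  rfl

/-- By the independence of field automorphisms, an element of the group algebra which acts as zero
on `L` has coefficients orthogonal to `χ`. -/
lemma sum_eq_zero_of_lift_holomorphRep_eq_zero {C F L : Type*} [Group C] [Fintype C]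
    [Fintype (MulAut C)] [Field F] [Field L] [Algebra F L]
    (χ : C →* L) (S : MulAut C →* Gal(L/F)) (h : ∀ u c, S u (χ c) = χ (u c))
    (hS : Function.Injective S) (x : MonoidAlgebra F (Holomorph C))
    (hx : MonoidAlgebra.lift F _ (Holomorph C) (holomorphRep χ S h) x = 0) (u : MulAut C) :
    ∑ c, algebraMap F L (x.coeff ⟨c, u⟩) * χ c = 0 := by
  have hli := (linearIndependent_toLinearMap F L L).comp (fun u ↦ (S u : L →ₐ[F] L))
    (fun a b hab ↦ hS (AlgEquiv.coe_toAlgHom_injective hab))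
  rw [Fintype.linearIndependent_iff] at hli
  refine hli (fun u ↦ ∑ c, algebraMap F L (x.coeff ⟨c, u⟩) * χ c) ?_ u
  rw [← hx, MonoidAlgebra.lift_holomorph_apply]
  ext y
  simp [holomorphRep, Finset.sum_mul, Algebra.smul_def, mul_assoc]

/-! ### Units modulo a power of two and their characters -/

/-- The class of `5` modulo a power of two. -/
def ZMod.fiveUnit (n : ℕ) : (ZMod (2 ^ n))ˣ :=
  ZMod.unitOfCoprime 5 (Nat.Coprime.pow_right n (by norm_num))

lemma ZMod.val_fiveUnit (n : ℕ) : (ZMod.fiveUnit n : ZMod (2 ^ n)) = 5 := by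
  simp [ZMod.fiveUnit]

lemma ZMod.orderOf_fiveUnit (m : ℕ) : orderOf (ZMod.fiveUnit (m + 2)) = 2 ^ m := by
  rw [← orderOf_units, ZMod.val_fiveUnit, ZMod.orderOf_five]

/-- The unit group modulo `2 ^ (m + 2)` is the product of `{±1}` and the group generated by `5`. -/
lemma ZMod.exists_units_two_pow_mulEquiv (m : ℕ) :
    Nonempty (ℤˣ × Subgroup.zpowers (ZMod.fiveUnit (m + 2)) ≃* (ZMod (2 ^ (m + 2)))ˣ) := by
  let B := Subgroup.zpowers (ZMod.fiveUnit (m + 2))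
  let f : ℤˣ × B →* (ZMod (2 ^ (m + 2)))ˣ :=
    (Units.map (Int.castRingHom (ZMod (2 ^ (m + 2)))).toMonoidHom).coprod B.subtype
  have h4 : 4 ∣ 2 ^ (m + 2) := ⟨2 ^ m, by ring⟩
  -- Injectivity: `5 ≡ 1` modulo 4, while `-1` is not; cardinality then gives bijectivity.
  have hB : B ≤ (ZMod.unitsMap h4).ker := by
    rw [Subgroup.zpowers_le, MonoidHom.mem_ker]
    ext
    rw [ZMod.unitsMap_val, ZMod.val_fiveUnit]
    rw [show (5 : ZMod (2 ^ (m + 2))) = ((5 : ℕ) : ZMod _) by norm_num, ZMod.cast_natCast h4]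
    rfl
  have hinj : Function.Injective f := by
    rw [injective_iff_map_eq_one]
    rintro ⟨s, b⟩ hsb
    have hs : s = 1 := by
      have h1 := congrArg (ZMod.unitsMap h4) hsb
      rw [show f (s, b) = Units.map (Int.castRingHom (ZMod (2 ^ (m + 2)))).toMonoidHom s * b from rfl,
        map_mul, MonoidHom.mem_ker.1 (hB b.2), mul_one, map_one] at h1
      rcases Int.units_eq_one_or s with rfl | rfl
      · rfl
      · have h2 := congrArg Units.val h1
        rw [ZMod.unitsMap_val] at h2
        simp only [Units.coe_map, Units.val_neg, Units.val_one] at h2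
        simp [ZMod.cast_neg h4, ZMod.cast_one h4] at h2
        exact absurd h2 (by decide)
    subst hs
    have : (b : (ZMod (2 ^ (m + 2)))ˣ) = 1 := by simpa [f] using hsb
    exact Prod.ext rfl (Subtype.ext this)
  refine ⟨MulEquiv.ofBijective f ((Nat.bijective_iff_injective_and_card f).2 ⟨hinj, ?_⟩)⟩
  rw [Nat.card_prod, Nat.card_zpowers, ZMod.orderOf_fiveUnit, Nat.card_eq_fintype_card,
    Nat.card_eq_fintype_card, ZMod.card_units_eq_totient,
    Nat.totient_prime_pow_succ Nat.prime_two, Fintype.card_units_int]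
  ring

/-- Characters of the product of `{±1}` and a cyclic group which separate rational functions. -/
lemma exists_characters_prod {U B : Type*} [Group U] [Fintype U] [Group B] [Fintype B]
    (e : ℤˣ × B ≃* U) {g : B} (hg : ∀ x, x ∈ Subgroup.zpowers g) {N : ℕ}
    (hN : Nat.card B = N) :
    ∃ θ : ∀ d : {d : ℕ // d ∈ Nat.divisors N}, Fin 2 → U →* CyclotomicField d ℚ,
      ∀ y : U → ℚ, (∀ (d : {d : ℕ // d ∈ Nat.divisors N}) (s : Fin 2),
        ∑ u, (y u : CyclotomicField d ℚ) * θ d s u = 0) → y = 0 := by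
  have hd0 (d : {d : ℕ // d ∈ Nat.divisors N}) : NeZero (d : ℕ) :=
    ⟨(Nat.pos_of_mem_divisors d.2).ne'⟩
  have hroot (d : {d : ℕ // d ∈ Nat.divisors N}) :
      ∃ β : B →* CyclotomicField d ℚ, IsPrimitiveRoot (β g) d := by
    have hz := IsCyclotomicExtension.zeta_spec d ℚ (CyclotomicField d ℚ)
    obtain ⟨β, hβ⟩ := hz.exists_monoidHom_apply_eq hg (by
      rw [hN]; exact Nat.dvd_of_mem_divisors d.2)
    exact ⟨β, hβ ▸ hz⟩
  choose β hβ using hroot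
  let α (K : Type) [Field K] (s : Fin 2) : ℤˣ →* K :=
    if s = 0 then 1 else (Int.castRingHom K).toMonoidHom.comp (Units.coeHom ℤ)
  refine ⟨fun d s ↦ ((α _ s).coprod (β d)).comp e.symm.toMonoidHom, fun y hy ↦ ?_⟩
  -- Half the sum and half the difference of the relations for the two characters of `{±1}` isolate
  -- the values at `1` and `-1`.
  have hs (d : {d : ℕ // d ∈ Nat.divisors N}) (t : ℤˣ) :
      ∑ b, (y (e (t, b)) : CyclotomicField d ℚ) * β d b = 0 := by
    have h0 := hy d 0
    have h1 := hy d 1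
    rw [← Equiv.sum_comp e.toEquiv, Fintype.sum_prod_type] at h0 h1
    rw [show (Finset.univ : Finset ℤˣ) = {1, -1} from rfl, Finset.sum_pair (by decide)] at h0 h1
    simp [α] at h0 h1
    rcases Int.units_eq_one_or t with rfl | rfl
    · linear_combination (h0 + h1) / 2
    · linear_combination (h0 - h1) / 2
  funext u
  obtain ⟨⟨t, b⟩, rfl⟩ := e.surjective u
  have hd (d : ℕ) (h : d ∣ Fintype.card B) : d ∈ Nat.divisors N := by
    rw [← hN, Nat.card_eq_fintype_card]
    exact Nat.mem_divisors.2 ⟨h, Fintype.card_ne_zero⟩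
  exact congrFun (eq_zero_of_forall_sum_character hg (fun b ↦ y (e (t, b))) fun d h ↦
    ⟨CyclotomicField d ℚ, inferInstance, inferInstance, β ⟨d, hd d h⟩, hβ ⟨d, hd d h⟩,
      hs ⟨d, hd d h⟩ t⟩) b

/-! ### The matrix and linear components -/

lemma MonoidAlgebra.commute_lift {F G A : Type*} [Field F] [Monoid G] [Ring A] [Algebra F A]
    (ρ : G →* A) {w : A} (h : ∀ g, Commute (ρ g) w) (x : MonoidAlgebra F G) :
    Commute (MonoidAlgebra.lift F A G ρ x) w := by
  rw [MonoidAlgebra.lift_apply]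
  exact Commute.sum_left _ _ _ fun g _ ↦ (h g).smul_left _

/-- Since `5` has order `2^(k-2)` modulo `2^k`, this exponent is `1` modulo `2^k`. -/
lemma pow_val_fiveUnit_pow {M : Type*} [Monoid M] {x : M} {n k : ℕ} (hk : 2 ≤ k) (hkn : k ≤ n)
    (hx : x ^ 2 ^ k = 1) :
    x ^ ((ZMod.fiveUnit n ^ 2 ^ (k - 2) : (ZMod (2 ^ n))ˣ) : ZMod (2 ^ n)).val = x := by
  obtain ⟨k, rfl⟩ := Nat.exists_eq_add_of_le' hk
  rw [Nat.add_sub_cancel]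
  have hdvd : 2 ^ (k + 2) ∣ 2 ^ n := pow_dvd_pow 2 hkn
  conv_rhs => rw [← pow_one x]
  refine pow_eq_pow_of_modEq ?_ hx
  rw [← ZMod.natCast_eq_natCast_iff, ← ZMod.cast_eq_val, Nat.cast_one, Units.val_pow_eq_pow_val,
    ZMod.val_fiveUnit, show (5 : ZMod (2 ^ n)) ^ 2 ^ k = ((5 ^ 2 ^ k : ℕ) : ZMod (2 ^ n)) by simp,
    ZMod.cast_natCast hdvd, Nat.cast_pow, Nat.cast_ofNat, ← ZMod.orderOf_five k, pow_orderOf_eq_one]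

/-- The representation of the holomorph on a cyclotomic field attached to a character of `C` of
order dividing `2 ^ k` decomposes into matrix representations of degree `2 ^ (k - 1)` over the
fields `ℚ(ζ_{2 ^ l})`, `l ≤ n - k`. -/
lemma exists_matrix_components {C L : Type*} [Group C] [Field L] [Algebra ℚ L] {n k : ℕ}
    [IsCyclotomicExtension {2 ^ n} ℚ L] (hk : 2 ≤ k) (hkn : k ≤ n)
    (χ : C →* L) (S : MulAut C →* Gal(L/ℚ)) (h : ∀ u c, S u (χ c) = χ (u c))
    (hχ : ∀ c, χ c ^ 2 ^ k = 1) :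
    ∃ Ψ : (l : {l : ℕ // l ∈ Finset.Icc 0 (n - k)}) → MonoidAlgebra ℚ (Holomorph C) →ₐ[ℚ]
        Matrix (Fin (2 ^ (k - 1))) (Fin (2 ^ (k - 1))) (CyclotomicField (2 ^ (l : ℕ)) ℚ),
      ∀ x, (∀ l, Ψ l x = 0) → MonoidAlgebra.lift ℚ _ _ (holomorphRep χ S h) x = 0 := by
  have hfin : FiniteDimensional ℚ L := IsCyclotomicExtension.finite_of_singleton (2 ^ n) ℚ L
  obtain ⟨e, he⟩ := IsCyclotomicExtension.exists_gal_equiv_units (N := 2 ^ n) L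
  -- This automorphism fixes the `2^k`-th roots of unity, hence the values of `χ`, and has order
  -- `2^(n-2) / 2^(k-2) = 2^(n-k)`.
  set σ : Gal(L/ℚ) := e.symm (ZMod.fiveUnit n ^ 2 ^ (k - 2)) with hσ
  have hσfix (c : C) : σ (χ c) = χ c := by
    have h1 : χ c ^ 2 ^ n = 1 := by
      rw [← Nat.add_sub_of_le hkn, pow_add, pow_mul, hχ, one_pow]
    rw [he σ _ h1, hσ, MulEquiv.apply_symm_apply, pow_val_fiveUnit_pow hk hkn (hχ c)]
  have hord : orderOf σ = 2 ^ (n - k) := by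
    rw [hσ, MulEquiv.orderOf_eq, orderOf_pow]
    obtain ⟨k, rfl⟩ := Nat.exists_eq_add_of_le' hk
    obtain ⟨r, rfl⟩ := Nat.exists_eq_add_of_le' hkn
    rw [← add_assoc, ZMod.orderOf_fiveUnit, Nat.add_sub_cancel,
      Nat.gcd_eq_right (pow_dvd_pow 2 (by lia)), Nat.pow_div (by lia) (by lia)]
    congr 1
    lia
  have hdim : Module.finrank ℚ L = 2 ^ (n - k) * 2 ^ (k - 1) := by
    rw [IsCyclotomicExtension.finrank (n := 2 ^ n) L (cyclotomic.irreducible_rat (by simp)),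
       Nat.totient_prime_pow Nat.prime_two (by lia),
      ← pow_add]
    simp only [Nat.add_one_sub_one, mul_one]
    congr 1
    lia
  have hcomm (g : Holomorph C) :
      Commute (holomorphRep χ S h g) (σ.toLinearMap : Module.End ℚ L) := by
    -- `Gal(L/ℚ)` is abelian.
    have hc : S g.right * σ = σ * S g.right := e.injective (by rw [map_mul, map_mul, mul_comm])
    refine LinearMap.ext fun y ↦ ?_
    have := AlgEquiv.congr_fun hc y
    simp only [AlgEquiv.mul_apply] at this
    simp [holomorphRep, hσfix, this]
  have hmin (l : ℕ) :
      minpoly ℚ ((IsCyclotomicExtension.zeta_spec (2 ^ l) ℚ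
        (CyclotomicField (2 ^ l) ℚ)).powerBasis ℚ).gen = cyclotomic (2 ^ l) ℚ := by
    rw [IsPrimitiveRoot.powerBasis_gen]
    exact ((IsCyclotomicExtension.zeta_spec (2 ^ l) ℚ _).minpoly_eq_cyclotomic_of_irreducible
      (cyclotomic.irreducible_rat (by simp))).symm
  have hex (l : {l : ℕ // l ∈ Finset.Icc 0 (n - k)}) := exists_algHom_matrix_of_commute
    (MonoidAlgebra.lift ℚ _ _ (holomorphRep χ S h)) (σ.toLinearMap : Module.End ℚ L)
    (MonoidAlgebra.commute_lift _ hcomm)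
    ((IsCyclotomicExtension.zeta_spec (2 ^ (l : ℕ)) ℚ
        (CyclotomicField (2 ^ (l : ℕ)) ℚ)).powerBasis ℚ) (N := 2 ^ (k - 1)) (by
      rw [hmin, σ.finrank_ker_aeval_cyclotomic hord hdim (Finset.mem_Icc.1 l.2).2,
        IsCyclotomicExtension.Rat.finrank (2 ^ (l : ℕ))])
  choose Ψ hΨ using hex
  refine ⟨Ψ, fun x hx ↦ LinearMap.ker_eq_top.1
    (σ.eq_top_of_ker_aeval_cyclotomic_le (hord ▸ pow_orderOf_eq_one σ) _ fun l hl ↦ ?_)⟩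
  rw [← hmin]
  exact hΨ ⟨l, Finset.mem_Icc.2 ⟨Nat.zero_le _, hl⟩⟩ x (hx _)

/-- The product of an invariant character of `C` and a character of `Aut(C)`, as a character of the
holomorph. -/
def holomorphCharacter {C K : Type*} [Group C] [Field K] (ε : C →* K) (θ : MulAut C →* K)
    (h : ∀ (u : MulAut C) c, ε (u c) = ε c) : Holomorph C →* K where
  toFun g := ε g.left * θ g.right
  map_one' := by simp
  map_mul' g g' := by simp [h, mul_mul_mul_comm]

/-- The linear characters of the holomorph of a cyclic group of order `2 ^ n` which extend an
invariant rational character of `C`. -/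
lemma exists_linear_components {C : Type*} [Group C] [IsCyclic C] [Fintype C] [Fintype (MulAut C)]
    {n : ℕ} (hn : 2 ≤ n) (hC : Nat.card C = 2 ^ n) (ε : C →* ℚ) (h : ∀ (u : MulAut C) c, ε (u c) = ε c) :
    ∃ Θ : (d : {d : ℕ // d ∈ Nat.divisors (2 ^ (n - 2))}) → Fin 2 →
        (MonoidAlgebra ℚ (Holomorph C) →ₐ[ℚ] CyclotomicField (d : ℕ) ℚ),
      ∀ x, (∀ d s, Θ d s x = 0) → ∀ u, ∑ c, x.coeff ⟨c, u⟩ * ε c = 0 := by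
  obtain ⟨m, rfl⟩ := Nat.exists_eq_add_of_le' hn
  obtain ⟨e₁, -⟩ := IsCyclic.exists_mulAut_equiv_units C hC
  obtain ⟨e₂⟩ := ZMod.exists_units_two_pow_mulEquiv m
  let _ := Fintype.ofFinite (Subgroup.zpowers (ZMod.fiveUnit (m + 2)))
  obtain ⟨θ, hθ⟩ := exists_characters_prod (e₂.trans e₁.symm)
    (g := ⟨ZMod.fiveUnit (m + 2), Subgroup.mem_zpowers _⟩)
    (fun x ↦ by
      obtain ⟨i, hi⟩ := x.2
      exact ⟨i, Subtype.ext hi⟩)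
    (N := 2 ^ (m + 2 - 2)) (by rw [Nat.card_zpowers, ZMod.orderOf_fiveUnit, Nat.add_sub_cancel])
  refine ⟨fun d s ↦ MonoidAlgebra.lift ℚ _ _ (holomorphCharacter
    ((algebraMap ℚ (CyclotomicField (d : ℕ) ℚ)).toMonoidHom.comp ε) (θ d s)
    (fun u c ↦ by simp [h])), fun x hx u ↦ ?_⟩
  refine congrFun (hθ (fun u ↦ ∑ c, x.coeff ⟨c, u⟩ * ε c) fun d s ↦ ?_) u
  rw [← hx d s, MonoidAlgebra.lift_holomorph_apply]
  simp [holomorphCharacter, Finset.sum_mul, Algebra.smul_def, mul_assoc]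

/-! ### Dimension count -/

lemma MonoidAlgebra.finrank_eq_natCard (F G : Type*) [Field F] [Group G] [Finite G] :
    Module.finrank F (MonoidAlgebra F G) = Nat.card G := by
  let _ := Fintype.ofFinite G
  rw [(MonoidAlgebra.coeffLinearEquiv F).finrank_eq, Module.finrank_finsupp_self,
    Nat.card_eq_fintype_card]

instance CyclotomicField.finiteDimensional_rat (d : ℕ) [NeZero d] :
    FiniteDimensional ℚ (CyclotomicField d ℚ) :=
  IsCyclotomicExtension.finite_of_singleton d ℚ _

lemma CyclotomicField.finrank_rat (d : ℕ) [NeZero d] :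
    Module.finrank ℚ (CyclotomicField d ℚ) = d.totient :=
  IsCyclotomicExtension.finrank (n := d) _ (cyclotomic.irreducible_rat (NeZero.pos d))

instance neZero_of_mem_divisors {N : ℕ} (d : {d : ℕ // d ∈ Nat.divisors N}) : NeZero (d : ℕ) :=
  ⟨(Nat.pos_of_mem_divisors d.2).ne'⟩

lemma finrank_pi_cyclotomicField_divisors {N : ℕ} :
    Module.finrank ℚ
      ((d : {d : ℕ // d ∈ Nat.divisors N}) → Fin 2 → CyclotomicField (d : ℕ) ℚ) = 2 * N := by
  rw [Module.finrank_pi_fintype]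
  simp only [Module.finrank_pi_fintype, CyclotomicField.finrank_rat, Finset.sum_const,
    Finset.card_univ, Fintype.card_fin, smul_eq_mul]
  rw [← Finset.mul_sum, Finset.sum_coe_sort (Nat.divisors N) Nat.totient, Nat.sum_totient]

lemma Nat.sum_Icc_totient_two_pow (r : ℕ) :
    ∑ l ∈ Finset.Icc 0 r, (2 ^ l).totient = 2 ^ r := by
  rw [← Nat.range_succ_eq_Icc_zero, ← Nat.sum_divisors_prime_pow Nat.prime_two, Nat.sum_totient]

lemma sum_Icc_two_pow_mul (n : ℕ) (hn : 2 ≤ n) :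
    2 ^ n + ∑ k ∈ Finset.Icc 2 n, 2 ^ (k - 1) * 2 ^ (k - 1) * 2 ^ (n - k) = 2 ^ n * 2 ^ (n - 1) := by
  induction n, hn using Nat.le_induction with
  | base => simp
  | succ n hn ih =>
    rw [Finset.sum_Icc_succ_top (by lia)]
    have h : ∑ k ∈ Finset.Icc 2 n, 2 ^ (k - 1) * 2 ^ (k - 1) * 2 ^ (n + 1 - k) =
        2 * ∑ k ∈ Finset.Icc 2 n, 2 ^ (k - 1) * 2 ^ (k - 1) * 2 ^ (n - k) := by
      rw [Finset.mul_sum]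
      refine Finset.sum_congr rfl fun k hk ↦ ?_
      rw [Nat.succ_sub (Finset.mem_Icc.1 hk).2, pow_succ]
      ring
    rw [h]
    obtain ⟨m, rfl⟩ := Nat.exists_eq_add_of_le' (show 1 ≤ n by lia)
    simp only [Nat.add_sub_cancel, Nat.sub_self, pow_zero, mul_one] at ih ⊢
    rw [pow_succ 2 (m + 1)]
    linear_combination 2 * ih

lemma finrank_wedderburn_components {n : ℕ} (hn : 2 ≤ n) :
    Module.finrank ℚ (
      ((d : {d : ℕ // d ∈ Nat.divisors (2 ^ (n - 2))}) → Fin 2 → CyclotomicField (d : ℕ) ℚ) ×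
      ((d : {d : ℕ // d ∈ Nat.divisors (2 ^ (n - 2))}) → Fin 2 → CyclotomicField (d : ℕ) ℚ) ×
      ((k : {k : ℕ // k ∈ Finset.Icc 2 n}) → (l : {l : ℕ // l ∈ Finset.Icc 0 (n - (k : ℕ))}) →
        Matrix (Fin (2 ^ ((k : ℕ) - 1))) (Fin (2 ^ ((k : ℕ) - 1)))
          (CyclotomicField (2 ^ (l : ℕ)) ℚ))) = 2 ^ n * 2 ^ (n - 1) := by
  rw [Module.finrank_prod, Module.finrank_prod, finrank_pi_cyclotomicField_divisors,
    Module.finrank_pi_fintype]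
  have h (k : {k : ℕ // k ∈ Finset.Icc 2 n}) : Module.finrank ℚ
      ((l : {l : ℕ // l ∈ Finset.Icc 0 (n - (k : ℕ))}) →
        Matrix (Fin (2 ^ ((k : ℕ) - 1))) (Fin (2 ^ ((k : ℕ) - 1)))
          (CyclotomicField (2 ^ (l : ℕ)) ℚ)) =
      2 ^ ((k : ℕ) - 1) * 2 ^ ((k : ℕ) - 1) * 2 ^ (n - (k : ℕ)) := by
    rw [Module.finrank_pi_fintype]
    simp only [Module.finrank_matrix, CyclotomicField.finrank_rat, Fintype.card_fin]
    rw [← Finset.mul_sum]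
    exact congrArg _ ((Finset.sum_coe_sort (Finset.Icc 0 (n - (k : ℕ)))
      (fun l ↦ (2 ^ l).totient)).trans (Nat.sum_Icc_totient_two_pow _))
  simp only [h]
  rw [Finset.sum_coe_sort (Finset.Icc 2 n)
    (fun k ↦ 2 ^ (k - 1) * 2 ^ (k - 1) * 2 ^ (n - k)), ← sum_Icc_two_pow_mul n hn]
  obtain ⟨m, rfl⟩ := Nat.exists_eq_add_of_le' hn
  rw [Nat.add_sub_cancel]
  ring

/-! ### The decomposition -/

theorem theorem9p3p1 (n : ℕ) (hn : 3 ≤ n) (C : Type*) [Group C] [IsCyclic C]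
    (hC : Nat.card C = 2 ^ n) :
    Nonempty (MonoidAlgebra ℚ (Holomorph C) ≃ₐ[ℚ]
      ((d : {d : ℕ // d ∈ Nat.divisors (2 ^ (n - 2))}) → Fin 2 → CyclotomicField (d : ℕ) ℚ) ×
      ((d : {d : ℕ // d ∈ Nat.divisors (2 ^ (n - 2))}) → Fin 2 → CyclotomicField (d : ℕ) ℚ) ×
      ((k : {k : ℕ // k ∈ Finset.Icc 2 n}) → (l : {l : ℕ // l ∈ Finset.Icc 0 (n - (k : ℕ))}) →
        Matrix (Fin (2 ^ ((k : ℕ) - 1))) (Fin (2 ^ ((k : ℕ) - 1)))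
          (CyclotomicField (2 ^ (l : ℕ)) ℚ))) := by
  have hfinC : Finite C := Nat.finite_of_card_ne_zero (by simp [hC])
  let _ := Fintype.ofFinite C
  let _ := Fintype.ofFinite (MulAut C)
  have hcardC : Fintype.card C = 2 ^ n := by rw [← Nat.card_eq_fintype_card, hC]
  have hpow (c : C) : c ^ 2 ^ n = 1 := by rw [← hC, pow_card_eq_one']
  obtain ⟨g, hg⟩ := IsCyclic.exists_generator (α := C)
  let L := CyclotomicField (2 ^ n) ℚ
  obtain ⟨e₁, he₁⟩ := IsCyclic.exists_mulAut_equiv_units C hC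
  obtain ⟨e₂, he₂⟩ := IsCyclotomicExtension.exists_gal_equiv_units (N := 2 ^ n) L
  let S : MulAut C ≃* Gal(L/ℚ) := e₁.trans e₂.symm
  have hS (χ : C →* L) (u : MulAut C) (c : C) : S u (χ c) = χ (u c) := by
    have h1 : χ c ^ 2 ^ n = 1 := by rw [← map_pow, hpow, map_one]
    rw [he₂ _ _ h1, he₁, map_pow]
    simp [S]
  have hζ := IsCyclotomicExtension.zeta_spec (2 ^ n) ℚ L
  obtain ⟨χ, hχ⟩ := hζ.exists_monoidHom_apply_eq hg hC.symm.dvd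
  let χ' (k : ℕ) : C →* L := (powMonoidHom (2 ^ (n - k))).comp χ
  have hχ' (k : ℕ) (hk : k ≤ n) : IsPrimitiveRoot (χ' k g) (2 ^ k) := by
    have : χ' k g = IsCyclotomicExtension.zeta (2 ^ n) ℚ L ^ 2 ^ (n - k) := by simp [χ', hχ]
    rw [this]
    exact hζ.pow (by simp) (by rw [← pow_add, Nat.sub_add_cancel hk])
  have hχ'pow (k : ℕ) (hk : k ≤ n) (c : C) : χ' k c ^ 2 ^ k = 1 := by
    change (χ c ^ 2 ^ (n - k)) ^ 2 ^ k = 1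
    rw [← pow_mul, ← pow_add, Nat.sub_add_cancel hk, ← map_pow, hpow, map_one]
  have hneg : IsPrimitiveRoot (-1 : ℚ) 2 := IsPrimitiveRoot.neg_one 0 (by norm_num)
  obtain ⟨ε, hε⟩ := hneg.exists_monoidHom_apply_eq hg (hC ▸ dvd_pow_self 2 (by lia))
  -- Automorphisms raise to odd powers, which fix values squaring to 1.
  have hεinv (u : MulAut C) (c : C) : ε (u c) = ε c := by
    have hsq : ε c ^ 2 = 1 := by
      obtain ⟨i, rfl⟩ := mem_powers_iff_mem_zpowers.2 (hg c)
      simp only [map_pow, hε]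
      rw [pow_right_comm, neg_one_sq, one_pow]
    have hcop := ZMod.val_coe_unit_coprime (e₁ u)
    rw [Nat.coprime_pow_right_iff (by lia), Nat.coprime_two_right] at hcop
    obtain ⟨i, hi⟩ := hcop
    rw [he₁, map_pow, hi, pow_succ, pow_mul, hsq, one_pow, one_mul]
  obtain ⟨Θ₀, hΘ₀⟩ := exists_linear_components (by lia) hC 1 (fun _ _ ↦ rfl)
  obtain ⟨Θ₁, hΘ₁⟩ := exists_linear_components (by lia) hC ε hεinv
  have hΨ (k : {k : ℕ // k ∈ Finset.Icc 2 n}) :=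
    exists_matrix_components (Finset.mem_Icc.1 k.2).1 (Finset.mem_Icc.1 k.2).2 (χ' k)
      S.toMonoidHom (hS (χ' k)) (hχ'pow k (Finset.mem_Icc.1 k.2).2)
  choose Ψ hΨ using hΨ
  let T := (AlgHom.pi fun d ↦ AlgHom.pi fun s ↦ Θ₀ d s).prod
    ((AlgHom.pi fun d ↦ AlgHom.pi fun s ↦ Θ₁ d s).prod
      (AlgHom.pi fun k ↦ AlgHom.pi fun l ↦ Ψ k l))
  have hinj : Function.Injective T := by
    rw [injective_iff_map_eq_zero]
    intro x hx
    have h₀ := hΘ₀ x fun d s ↦ congrFun (congrFun (congrArg Prod.fst hx) d) s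
    have h₁ := hΘ₁ x fun d s ↦ congrFun (congrFun (congrArg (·.2.1) hx) d) s
    have h₂ (k) := hΨ k x fun l ↦ congrFun (congrFun (congrArg (·.2.2) hx) k) l
    have hcoeff (u : MulAut C) : (fun c ↦ x.coeff ⟨c, u⟩) = 0 := by
      refine eq_zero_of_forall_sum_character hg _ fun d hd ↦ ?_
      rw [hcardC] at hd
      obtain ⟨k, hk, rfl⟩ := (Nat.dvd_prime_pow Nat.prime_two).1 hd
      -- Orders 1 and 2 are handled by the linear components, orders `2^k` with `k ≥ 2` by the
      -- action on `L`.
      match k, hk with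
      | 0, _ => exact ⟨ℚ, inferInstance, inferInstance, 1, by simp, by simpa using h₀ u⟩
      | 1, _ => exact ⟨ℚ, inferInstance, inferInstance, ε, by simpa [hε] using hneg, by
          simpa using h₁ u⟩
      | k + 2, hk =>
        refine ⟨L, inferInstance, inferInstance, χ' (k + 2), hχ' _ hk, ?_⟩
        have := sum_eq_zero_of_lift_holomorphRep_eq_zero _ _ _ S.injective x
          (h₂ ⟨k + 2, Finset.mem_Icc.2 ⟨by lia, hk⟩⟩) u
        simpa using this
    ext ⟨c, u⟩
    exact congrFun (hcoeff u) c
  have hfinG : Finite (Holomorph C) := Finite.of_equiv _ SemidirectProduct.equivProd.symm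
  have hfinA : FiniteDimensional ℚ (MonoidAlgebra ℚ (Holomorph C)) :=
    (MonoidAlgebra.coeffLinearEquiv ℚ).symm.finiteDimensional
  have hrank : Module.finrank ℚ (MonoidAlgebra ℚ (Holomorph C)) = 2 ^ n * 2 ^ (n - 1) := by
    rw [MonoidAlgebra.finrank_eq_natCard, SemidirectProduct.card, IsCyclic.card_mulAut, hC,
      Nat.totient_prime_pow Nat.prime_two (by lia)]
    simp
  refine ⟨AlgEquiv.ofBijective T ⟨hinj, ?_⟩⟩
  exact (LinearMap.injective_iff_surjective_of_finrank_eq_finrank (f := T.toLinearMap)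
    (hrank.trans (finrank_wedderburn_components (by lia)).symm)).1 hinj
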